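/- Let $(\Gamma,\Sigma,\sigma)$ be a finite measure space and consider the real spaces $L_p(\Gamma)=L_p(\Gamma,\Sigma,\sigma)$. Let $S=(S_t)_{t>0}$ be a self-adjoint Markov semigroup on $L_2(\Gamma)$, that is, a $C_0$-semigroup of bounded self-adjoint operators on $L_2(\Gamma)$ such that for every $t>0$ one has $S_t \mathbb{1}_\Gamma=\mathbb{1}_\Gamma$, and $S_tf\ge 0$ for all $f\in L_2(\Gamma)$ with $f\ge 0$. For $p\in[1,\infty)$ and $t>0$ let $S^{(p)}_t$ denote the unique bounded operator on $L_p(\Gamma)$ with $S^{(p)}_tf=S_tf$ for all $f\in L_p(\Gamma)\cap L_2(\Gamma)$. For $f\in L_1(\Gamma)$ let $$Pf=\frac{1}{\sigma(\Gamma)}\Big(\int_\Gamma f\,d\sigma\Big)\mathbb{1}_\Gamma$$ (with $Pf=0$ in the trivial case $\sigma(\Gamma)=0$). The semigroup $S$ is called irreducible if every $\Gamma_1\in\Sigma$ with $S_tL_2(\Gamma_1)\subset L_2(\Gamma_1)$ for all $t>0$ satisfies $\sigma(\Gamma_1)=0$ or $\sigma(\Gamma\setminus\Gamma_1)=0$,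 where $L_2(\Gamma_1)=\{f\in L_2(\Gamma): f=0 \text{ a.e. on } \Gamma\setminus\Gamma_1\}$. Theorem. The following are equivalent. (i) $S$ is irreducible. (ii) There exists a $p\in[1,\infty)$ such that $\lim_{t\to\infty}S^{(p)}_tf=Pf$ in $L_p(\Gamma)$ for all $f\in L_p(\Gamma)$. (iii) For all $p\in[1,\infty)$ one has $\lim_{t\to\infty}S^{(p)}_tf=Pf$ in $L_p(\Gamma)$ for all $f\in L_p(\Gamma)$. -/

import Mathlib

open MeasureTheory Filter Topology
open scoped ENNReal

noncomputable section

namespace MarkovSemigroup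

/-- A `C₀`-semigroup `(S_t)_{t > 0}` of bounded operators on a normed space.  The family is indexed
by `ℝ`, but only its members with a positive parameter play a role. -/
structure IsC0Semigroup {H : Type*} [NormedAddCommGroup H] [NormedSpace ℝ H]
    (S : ℝ → H →L[ℝ] H) : Prop where
  map_add : ∀ s t : ℝ, 0 < s → 0 < t → S (s + t) = (S s).comp (S t)
  tendsto_zero : ∀ f : H, Tendsto (fun t : ℝ => S t f) (𝓝[>] 0) (𝓝 f)

variable {Γ : Type*} [MeasurableSpace Γ]

/-- A Markov operator on `L₂(Γ)`: `T 𝟙 = 𝟙`, and `T f ≥ 0` whenever `f ≥ 0`. -/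
structure IsMarkovOperator (σ : Measure Γ) [IsFiniteMeasure σ]
    (T : Lp ℝ 2 σ →L[ℝ] Lp ℝ 2 σ) : Prop where
  map_one : T (Lp.const 2 σ (1 : ℝ)) = Lp.const 2 σ (1 : ℝ)
  map_nonneg : ∀ f : Lp ℝ 2 σ, 0 ≤ f → 0 ≤ T f

/-- A self-adjoint Markov semigroup on `L₂(Γ)`: a `C₀`-semigroup that consists of self-adjoint
Markov operators. -/
structure IsSelfAdjointMarkovSemigroup (σ : Measure Γ) [IsFiniteMeasure σ]
    (S : ℝ → Lp ℝ 2 σ →L[ℝ] Lp ℝ 2 σ) : Prop where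
  isC0Semigroup : IsC0Semigroup S
  isMarkovOperator : ∀ t : ℝ, 0 < t → IsMarkovOperator σ (S t)
  isSelfAdjoint : ∀ t : ℝ, 0 < t → IsSelfAdjoint (S t)

/-- The closed subspace `L₂(Γ₁) = {f ∈ L₂(Γ) : f = 0 a.e. on Γ \ Γ₁}`. -/
def L2On (σ : Measure Γ) (Γ₁ : Set Γ) : Set (Lp ℝ 2 σ) :=
  {f | ∀ᵐ x ∂σ, x ∉ Γ₁ → f x = 0}

/-- Irreducibility: the only measurable sets `Γ₁` for which `L₂(Γ₁)` is invariant under all `S_t`,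
`t > 0`, are the null sets and their complements. -/
def IsIrreducible (σ : Measure Γ) (S : ℝ → Lp ℝ 2 σ →L[ℝ] Lp ℝ 2 σ) : Prop :=
  ∀ Γ₁ : Set Γ, MeasurableSet Γ₁ →
    (∀ t : ℝ, 0 < t → ∀ f ∈ L2On σ Γ₁, S t f ∈ L2On σ Γ₁) →
    σ Γ₁ = 0 ∨ σ Γ₁ᶜ = 0

/-- `Tp` is a bounded operator on `L_p(Γ)` such that `Tp f = T f` for all `f ∈ L_p(Γ) ∩ L₂(Γ)`. -/
def IsLpExtension {σ : Measure Γ} (T : Lp ℝ 2 σ →L[ℝ] Lp ℝ 2 σ) (p : ℝ≥0∞) [Fact (1 ≤ p)]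
    (Tp : Lp ℝ p σ →L[ℝ] Lp ℝ p σ) : Prop :=
  ∀ (f : Lp ℝ 2 σ) (g : Lp ℝ p σ), f =ᵐ[σ] g → T f =ᵐ[σ] Tp g

open Classical in
/-- The operator `T^{(p)}` on `L_p(Γ)`: the bounded operator on `L_p(Γ)` that agrees with `T` on
`L_p(Γ) ∩ L₂(Γ)`.  For a self-adjoint Markov operator `T` and `1 ≤ p < ∞` it exists and is unique,
as is proved in `existsUnique_isLpExtension` below, so that the default value is not used. -/
def lpExtension {σ : Measure Γ} (T : Lp ℝ 2 σ →L[ℝ] Lp ℝ 2 σ) (p : ℝ≥0∞) [Fact (1 ≤ p)] :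
    Lp ℝ p σ →L[ℝ] Lp ℝ p σ :=
  if h : ∃ Tp : Lp ℝ p σ →L[ℝ] Lp ℝ p σ, IsLpExtension T p Tp then h.choose else 0

/-- The average `P f = (σ(Γ)⁻¹ ∫ f dσ) 𝟙`, as an element of `L_p(Γ)`. -/
def mean (σ : Measure Γ) [IsFiniteMeasure σ] (p : ℝ≥0∞) (f : Lp ℝ p σ) : Lp ℝ p σ :=
  Lp.const p σ ((σ.real Set.univ)⁻¹ * ∫ x, f x ∂σ)

theorem tangent_le {q c x : ℝ} (hq : 1 ≤ q) (hc : 0 < c) (hx : 0 ≤ x) :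
    (c ^ q - q * c ^ (q - 1) * c) + q * c ^ (q - 1) * x ≤ x ^ q := by
  have h := one_add_mul_self_le_rpow_one_add (s := x / c - 1) (p := q)
    (by have := div_nonneg hx hc.le; linarith) hq
  have h1 : (1 + (x / c - 1)) = x / c := by ring
  rw [h1, Real.div_rpow hx hc.le, le_div_iff₀ (Real.rpow_pos_of_pos hc q)] at h
  have h2 : c ^ q = c ^ (q - 1) * c := by
    rw [Real.rpow_sub_one hc.ne']; field_simp
  refine le_trans (le_of_eq ?_) h
  rw [h2]; field_simp; ring

theorem IsMarkovOperator.map_const {σ : Measure Γ} [IsFiniteMeasure σ]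
    {T : Lp ℝ 2 σ →L[ℝ] Lp ℝ 2 σ} (hT : IsMarkovOperator σ T) (a : ℝ) :
    T (Lp.const 2 σ a) = Lp.const 2 σ a := by
  have h : Lp.const 2 σ a = a • Lp.const 2 σ (1 : ℝ) := by
    simpa using ((Lp.constₗ 2 σ ℝ).map_smul a (1 : ℝ))
  rw [h, map_smul, hT.map_one]

theorem IsMarkovOperator.mono {σ : Measure Γ} [IsFiniteMeasure σ]
    {T : Lp ℝ 2 σ →L[ℝ] Lp ℝ 2 σ} (hT : IsMarkovOperator σ T) {f g : Lp ℝ 2 σ} (h : f ≤ g) :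
    T f ≤ T g := by
  have := hT.map_nonneg (g - f) (sub_nonneg.2 h)
  rw [map_sub] at this
  exact sub_nonneg.1 this

/-- Jensen's inequality `|T f|^q ≤ T |f|^q` for a Markov operator. -/
theorem IsMarkovOperator.abs_rpow_le {σ : Measure Γ} [IsFiniteMeasure σ]
    {T : Lp ℝ 2 σ →L[ℝ] Lp ℝ 2 σ} (hT : IsMarkovOperator σ T) {q : ℝ} (hq : 1 ≤ q)
    (f G : Lp ℝ 2 σ) (hG : ∀ᵐ x ∂σ, G x = |f x| ^ q) :
    ∀ᵐ x ∂σ, |T f x| ^ q ≤ T G x := by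
  have hF := Lp.coeFn_abs f
  have h1 : T f ≤ T |f| := hT.mono (by
    rw [← Lp.coeFn_le]; filter_upwards [hF] with x hx; rw [hx]; exact le_abs_self _)
  have h2 : -T f ≤ T |f| := by
    rw [← map_neg]
    refine hT.mono ?_
    rw [← Lp.coeFn_le]
    filter_upwards [hF, Lp.coeFn_neg f] with x hx hx'
    rw [hx, hx']; exact neg_le_abs _
  have h3 : 0 ≤ T G := hT.map_nonneg G (by
    rw [← Lp.coeFn_nonneg]; filter_upwards [hG] with x hx; rw [hx, Pi.zero_apply]; positivity)
  have h4 : ∀ c : ℚ, 0 < c → ∀ᵐ x ∂σ,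
      (((c : ℝ) ^ q - q * (c : ℝ) ^ (q - 1) * c) + q * (c : ℝ) ^ (q - 1) * T |f| x) ≤ T G x := by
    intro c hc
    have hc' : (0 : ℝ) < c := by exact_mod_cast hc
    have key : Lp.const 2 σ ((c : ℝ) ^ q - q * (c : ℝ) ^ (q - 1) * c)
        + (q * (c : ℝ) ^ (q - 1)) • |f| ≤ G := by
      rw [← Lp.coeFn_le]
      filter_upwards [hF, hG, Lp.coeFn_add (Lp.const 2 σ ((c : ℝ) ^ q - q * (c : ℝ) ^ (q - 1) * c))
        ((q * (c : ℝ) ^ (q - 1)) • |f|), Lp.coeFn_smul (q * (c : ℝ) ^ (q - 1)) |f|,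
        Lp.coeFn_const 2 σ ((c : ℝ) ^ q - q * (c : ℝ) ^ (q - 1) * c)] with x a1 a2 a3 a4 a5
      rw [a3, Pi.add_apply, a4, Pi.smul_apply, a5, a1, a2, smul_eq_mul]
      exact tangent_le hq hc' (abs_nonneg _)
    have key2 := hT.mono key
    rw [map_add, map_smul, hT.map_const, ← Lp.coeFn_le] at key2
    filter_upwards [key2, Lp.coeFn_add (Lp.const 2 σ ((c : ℝ) ^ q - q * (c : ℝ) ^ (q - 1) * c))
        ((q * (c : ℝ) ^ (q - 1)) • T |f|), Lp.coeFn_smul (q * (c : ℝ) ^ (q - 1)) (T |f|),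
        Lp.coeFn_const 2 σ ((c : ℝ) ^ q - q * (c : ℝ) ^ (q - 1) * c)] with x a1 a3 a4 a5
    rw [a3, Pi.add_apply, a4, Pi.smul_apply, a5, smul_eq_mul] at a1
    exact a1
  have h5 : ∀ᵐ x ∂σ, ∀ c : ℚ, 0 < c →
      (((c : ℝ) ^ q - q * (c : ℝ) ^ (q - 1) * c) + q * (c : ℝ) ^ (q - 1) * T |f| x) ≤ T G x := by
    rw [ae_all_iff]; intro c
    by_cases hc : 0 < c
    · filter_upwards [h4 c hc] with x hx _ using hx
    · exact ae_of_all _ fun x h => absurd h hc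
  rw [← Lp.coeFn_le] at h1 h2
  rw [← Lp.coeFn_nonneg] at h3
  filter_upwards [h1, h2, h3, h5, Lp.coeFn_neg (T f)] with x a1 a2 a3 a4 a5
  rw [a5, Pi.neg_apply] at a2
  have hle : |T f x| ≤ T |f| x := abs_le.2 ⟨by linarith, a1⟩
  set y := T |f| x
  have hy : 0 ≤ y := (abs_nonneg _).trans hle
  refine (Real.rpow_le_rpow (abs_nonneg _) hle (by linarith)).trans ?_
  rcases hy.eq_or_lt with h0 | hpos
  · rw [← h0, Real.zero_rpow (by linarith)]; exact a3
  by_contra! hlt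
  have hcont : ContinuousAt
      (fun c : ℝ => (c ^ q - q * c ^ (q - 1) * c) + q * c ^ (q - 1) * y) y := by
    have e1 : ContinuousAt (fun c : ℝ => c ^ q) y :=
      Real.continuousAt_rpow_const _ _ (Or.inl hpos.ne')
    have e2 : ContinuousAt (fun c : ℝ => c ^ (q - 1)) y :=
      Real.continuousAt_rpow_const _ _ (Or.inl hpos.ne')
    exact (e1.sub ((continuousAt_const.mul e2).mul continuousAt_id)).add
      ((continuousAt_const.mul e2).mul continuousAt_const)
  have hev := (hcont.eventually (lt_mem_nhds (a := T G x) (by simpa using hlt))).and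
    (lt_mem_nhds hpos)
  obtain ⟨c, hc⟩ := Rat.isDenseEmbedding_coe_real.dense.exists_mem_open isOpen_interior
    ⟨y, mem_interior_iff_mem_nhds.2 hev⟩
  have hc' := interior_subset hc
  have hc0 : (0 : ℚ) < c := by exact_mod_cast hc'.2
  exact absurd (a4 c hc0) (not_le.2 hc'.1)

theorem integral_map_eq {σ : Measure Γ} [IsFiniteMeasure σ] {T : Lp ℝ 2 σ →L[ℝ] Lp ℝ 2 σ}
    (hT : IsMarkovOperator σ T) (hsa : IsSelfAdjoint T) (f : Lp ℝ 2 σ) :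
    ∫ x, T f x ∂σ = ∫ x, f x ∂σ := by
  have key : ∀ g : Lp ℝ 2 σ, inner ℝ (Lp.const 2 σ (1 : ℝ)) g = ∫ x, g x ∂σ := by
    intro g
    rw [L2.inner_def]
    refine integral_congr_ae ?_
    filter_upwards [Lp.coeFn_const 2 σ (1 : ℝ)] with x hx
    rw [hx]; simp
  rw [← key, ← key, ← ContinuousLinearMap.adjoint_inner_left,
    ← ContinuousLinearMap.star_eq_adjoint, hsa.star_eq, hT.map_one]

theorem eLpNorm_map_le_of_memLp {σ : Measure Γ} [IsFiniteMeasure σ]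
    {T : Lp ℝ 2 σ →L[ℝ] Lp ℝ 2 σ} (hT : IsMarkovOperator σ T) (hsa : IsSelfAdjoint T)
    {p : ℝ≥0∞} (hp : 1 ≤ p) (hp' : p ≠ ∞) (f : Lp ℝ 2 σ)
    (hf : MemLp (fun x => |f x| ^ p.toReal) 2 σ) :
    eLpNorm (T f) p σ ≤ eLpNorm f p σ := by
  have hp0 : p ≠ 0 := (zero_lt_one.trans_le hp).ne'
  have hq : 1 ≤ p.toReal := by
    simpa using ENNReal.toReal_mono hp' hp
  have hG : ∀ᵐ x ∂σ, (hf.toLp : Γ → ℝ) x = |f x| ^ p.toReal := hf.coeFn_toLp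
  have hJ := hT.abs_rpow_le hq f hf.toLp hG
  have hG0 : 0 ≤ᵐ[σ] hf.toLp := by
    filter_upwards [hG] with x hx; rw [hx, Pi.zero_apply]; positivity
  have hTG0 : 0 ≤ᵐ[σ] T hf.toLp := by
    filter_upwards [hJ] with x hx; exact le_trans (by positivity) hx
  have hi : ∀ g : Lp ℝ 2 σ, Integrable g σ := fun g =>
    (Lp.memLp g).integrable (by norm_num)
  have hnorm : ∀ y : ℝ, ‖y‖ₑ ^ p.toReal = ENNReal.ofReal (|y| ^ p.toReal) := by
    intro y
    rw [← ofReal_norm, Real.norm_eq_abs,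
      ENNReal.ofReal_rpow_of_nonneg (abs_nonneg _) (by linarith)]
  rw [eLpNorm_eq_lintegral_rpow_enorm_toReal hp0 hp',
    eLpNorm_eq_lintegral_rpow_enorm_toReal hp0 hp']
  refine ENNReal.rpow_le_rpow ?_ (by positivity)
  calc ∫⁻ x, ‖T f x‖ₑ ^ p.toReal ∂σ ≤ ∫⁻ x, ENNReal.ofReal (T hf.toLp x) ∂σ := by
        refine lintegral_mono_ae ?_
        filter_upwards [hJ] with x hx
        rw [hnorm]; exact ENNReal.ofReal_le_ofReal hx
    _ = ENNReal.ofReal (∫ x, T hf.toLp x ∂σ) :=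
        (ofReal_integral_eq_lintegral_ofReal (hi _) hTG0).symm
    _ = ENNReal.ofReal (∫ x, (hf.toLp : Γ → ℝ) x ∂σ) := by rw [integral_map_eq hT hsa]
    _ = ∫⁻ x, ENNReal.ofReal ((hf.toLp : Γ → ℝ) x) ∂σ :=
        ofReal_integral_eq_lintegral_ofReal (hi _) hG0
    _ = ∫⁻ x, ‖f x‖ₑ ^ p.toReal ∂σ := by
        refine lintegral_congr_ae ?_
        filter_upwards [hG] with x hx
        rw [hnorm, hx]

/-- Simultaneous approximation by simple functions in `L₂` and `L_p`. -/
theorem exists_approx {σ : Measure Γ} [IsFiniteMeasure σ] {p : ℝ≥0∞} (hp' : p ≠ ∞)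
    (f : Lp ℝ 2 σ) (hf : MemLp f p σ) :
    ∃ s : ℕ → SimpleFunc Γ ℝ, Tendsto (fun n => eLpNorm (⇑(s n) - ⇑f) 2 σ) atTop (𝓝 0) ∧
      Tendsto (fun n => eLpNorm (⇑(s n) - ⇑f) p σ) atTop (𝓝 0) := by
  have hm : Measurable f := (Lp.stronglyMeasurable f).measurable
  exact ⟨fun n => SimpleFunc.approxOn f hm (Set.range f ∪ {0}) 0 (by simp) n,
    SimpleFunc.tendsto_approxOn_range_Lp_eLpNorm (by norm_num) hm (Lp.memLp f).2,
    SimpleFunc.tendsto_approxOn_range_Lp_eLpNorm hp' hm hf.2⟩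

theorem memLp_simpleFunc {σ : Measure Γ} [IsFiniteMeasure σ] (s : SimpleFunc Γ ℝ) (p : ℝ≥0∞) :
    MemLp s p σ :=
  SimpleFunc.memLp_of_finite_measure_preimage p fun _ _ => measure_lt_top σ _

/-- A self-adjoint Markov operator is contractive for the `L_p`-norm. -/
theorem eLpNorm_map_le {σ : Measure Γ} [IsFiniteMeasure σ]
    {T : Lp ℝ 2 σ →L[ℝ] Lp ℝ 2 σ} (hT : IsMarkovOperator σ T) (hsa : IsSelfAdjoint T)
    {p : ℝ≥0∞} (hp : 1 ≤ p) (hp' : p ≠ ∞) (f : Lp ℝ 2 σ) (hf : MemLp f p σ) :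
    eLpNorm (T f) p σ ≤ eLpNorm f p σ := by
  obtain ⟨s, hs2, hsp⟩ := exists_approx hp' f hf
  have hs : ∀ n, MemLp (s n) 2 σ := fun n => memLp_simpleFunc _ _
  set u : ℕ → Lp ℝ 2 σ := fun n => (hs n).toLp with hu
  have hlim : Tendsto u atTop (𝓝 f) := by
    rw [Lp.tendsto_Lp_iff_tendsto_eLpNorm']
    refine hs2.congr fun n => eLpNorm_congr_ae ?_
    filter_upwards [(hs n).coeFn_toLp] with x hx
    simp [hu, hx]
  have hTlim : Tendsto (fun n => T (u n)) atTop (𝓝 (T f)) :=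
    (T.continuous.tendsto f).comp hlim
  obtain ⟨φ, hφ, hae⟩ := (tendstoInMeasure_of_tendsto_Lp hTlim).exists_seq_tendsto_ae
  have hb : ∀ n, eLpNorm (T (u n)) p σ ≤ eLpNorm (⇑(s n) - ⇑f) p σ + eLpNorm f p σ := by
    intro n
    have e1 : eLpNorm (T (u n)) p σ ≤ eLpNorm (u n) p σ := by
      refine eLpNorm_map_le_of_memLp hT hsa hp hp' _ ?_
      refine (memLp_simpleFunc ((s n).map fun y => |y| ^ p.toReal) 2).ae_eq ?_
      filter_upwards [(hs n).coeFn_toLp] with x hx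
      simp [hu, hx]
    have e2 : eLpNorm (u n) p σ = eLpNorm (s n) p σ := eLpNorm_congr_ae (hs n).coeFn_toLp
    have e3 : (s n : Γ → ℝ) = (⇑(s n) - ⇑f) + ⇑f := by simp
    rw [e2, e3] at e1
    exact e1.trans (eLpNorm_add_le ((s n).aestronglyMeasurable.sub hf.1) hf.1 hp)
  have hR : Tendsto (fun n => eLpNorm (⇑(s (φ n)) - ⇑f) p σ + eLpNorm f p σ) atTop
      (𝓝 (0 + eLpNorm f p σ)) :=
    (hsp.comp hφ.tendsto_atTop).add tendsto_const_nhds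
  calc eLpNorm (T f) p σ ≤ atTop.liminf fun n => eLpNorm (T (u (φ n))) p σ :=
        Lp.eLpNorm_lim_le_liminf_eLpNorm (fun n => Lp.aestronglyMeasurable _) _ hae
    _ ≤ atTop.liminf fun n => eLpNorm (⇑(s (φ n)) - ⇑f) p σ + eLpNorm f p σ :=
        liminf_le_liminf (Eventually.of_forall fun n => hb (φ n))
    _ = eLpNorm f p σ := by rw [hR.liminf_eq, zero_add]

/-- The functions of `L₂(Γ)` that lie in `L_p(Γ)`. -/
def interLp (σ : Measure Γ) (p : ℝ≥0∞) : Submodule ℝ (Lp ℝ 2 σ) where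
  carrier := {f | MemLp f p σ}
  add_mem' {f g} hf hg := (MemLp.add hf hg).ae_eq (Lp.coeFn_add f g).symm
  zero_mem' := (MemLp.zero (ε := ℝ)).ae_eq (Lp.coeFn_zero ℝ 2 σ).symm
  smul_mem' c f hf := (MemLp.const_smul hf c).ae_eq (Lp.coeFn_smul c f).symm

theorem memLp_of_mem {σ : Measure Γ} {p : ℝ≥0∞} (f : interLp σ p) :
    MemLp (f : Lp ℝ 2 σ) p σ := f.2

/-- The inclusion `L_p(Γ) ∩ L₂(Γ) → L_p(Γ)`. -/
def interLpIncl (σ : Measure Γ) (p : ℝ≥0∞) : interLp σ p →ₗ[ℝ] Lp ℝ p σ where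
  toFun f := (memLp_of_mem f).toLp
  map_add' f g := by
    refine Lp.ext ?_
    filter_upwards [(memLp_of_mem (f + g)).coeFn_toLp, (memLp_of_mem f).coeFn_toLp,
      (memLp_of_mem g).coeFn_toLp, Lp.coeFn_add (memLp_of_mem f).toLp (memLp_of_mem g).toLp,
      Lp.coeFn_add (f : Lp ℝ 2 σ) g] with x h1 h2 h3 h4 h5
    rw [h1, h4, Pi.add_apply, h2, h3, Submodule.coe_add, h5, Pi.add_apply]
  map_smul' c f := by
    refine Lp.ext ?_
    filter_upwards [(memLp_of_mem (c • f)).coeFn_toLp, (memLp_of_mem f).coeFn_toLp,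
      Lp.coeFn_smul c (memLp_of_mem f).toLp, Lp.coeFn_smul c (f : Lp ℝ 2 σ)] with x h1 h2 h3 h4
    rw [h1, RingHom.id_apply, h3, Pi.smul_apply, h2, Submodule.coe_smul, h4, Pi.smul_apply]

theorem coeFn_interLpIncl {σ : Measure Γ} {p : ℝ≥0∞} (f : interLp σ p) :
    interLpIncl σ p f =ᵐ[σ] (f : Lp ℝ 2 σ) :=
  (memLp_of_mem f).coeFn_toLp

theorem denseRange_interLpIncl (σ : Measure Γ) [IsFiniteMeasure σ] (p : ℝ≥0∞) [Fact (1 ≤ p)]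
    (hp' : p ≠ ∞) : DenseRange (interLpIncl σ p) := by
  refine (Lp.simpleFunc.denseRange (E := ℝ) (μ := σ) hp').mono ?_
  rintro _ ⟨g, rfl⟩
  have h2 : MemLp (Lp.simpleFunc.toSimpleFunc g) 2 σ := memLp_simpleFunc _ _
  have hae : h2.toLp =ᵐ[σ] (g : Lp ℝ p σ) :=
    h2.coeFn_toLp.trans (Lp.simpleFunc.toSimpleFunc_eq_toFun g)
  refine ⟨⟨h2.toLp, (Lp.memLp (g : Lp ℝ p σ)).ae_eq hae.symm⟩, ?_⟩
  refine Lp.ext ?_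
  exact (coeFn_interLpIncl _).trans hae

/-- For a self-adjoint Markov operator `T` and `1 ≤ p < ∞` there is a unique bounded operator on
`L_p(Γ)` that agrees with `T` on `L_p(Γ) ∩ L₂(Γ)`. -/
theorem existsUnique_isLpExtension {σ : Measure Γ} [IsFiniteMeasure σ]
    {T : Lp ℝ 2 σ →L[ℝ] Lp ℝ 2 σ} (hT : IsMarkovOperator σ T) (hsa : IsSelfAdjoint T)
    (p : ℝ≥0∞) [hp : Fact (1 ≤ p)] (hp' : p ≠ ∞) :
    ∃! Tp : Lp ℝ p σ →L[ℝ] Lp ℝ p σ, IsLpExtension T p Tp := by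
  have hle : ∀ f ∈ interLp σ p, T f ∈ interLp σ p := fun f hf =>
    ⟨Lp.aestronglyMeasurable _, (eLpNorm_map_le hT hsa hp.out hp' f hf).trans_lt hf.2⟩
  have hd := denseRange_interLpIncl σ p hp'
  let T₀ : interLp σ p →ₗ[ℝ] Lp ℝ p σ :=
    (interLpIncl σ p).comp ((T : Lp ℝ 2 σ →ₗ[ℝ] Lp ℝ 2 σ).restrict hle)
  have hT₀ : ∀ f : interLp σ p, T₀ f =ᵐ[σ] T f :=
    fun f => coeFn_interLpIncl _
  have hbd : ∀ f : interLp σ p, ‖T₀ f‖ ≤ 1 * ‖interLpIncl σ p f‖ := by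
    intro f
    rw [one_mul, Lp.norm_def, Lp.norm_def]
    refine ENNReal.toReal_mono (Lp.eLpNorm_ne_top _) ?_
    rw [eLpNorm_congr_ae (hT₀ f), eLpNorm_congr_ae (coeFn_interLpIncl f)]
    exact eLpNorm_map_le hT hsa hp.out hp' _ f.2
  refine ⟨T₀.extendOfNorm (interLpIncl σ p), ?_, ?_⟩
  · intro f g hfg
    have hf : f ∈ interLp σ p := (Lp.memLp g).ae_eq hfg.symm
    have hg : interLpIncl σ p ⟨f, hf⟩ = g := Lp.ext ((coeFn_interLpIncl _).trans hfg)
    rw [← hg, LinearMap.extendOfNorm_eq hd ⟨1, hbd⟩]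
    exact (hT₀ ⟨f, hf⟩).symm
  · intro R hR
    refine (LinearMap.extendOfNorm_unique hd 1 hbd R ?_).symm
    ext1 f
    refine Lp.ext ?_
    exact (hR f _ (coeFn_interLpIncl f).symm).symm.trans (hT₀ f).symm

theorem isLpExtension_lpExtension {σ : Measure Γ} [IsFiniteMeasure σ]
    {T : Lp ℝ 2 σ →L[ℝ] Lp ℝ 2 σ} (hT : IsMarkovOperator σ T) (hsa : IsSelfAdjoint T)
    (p : ℝ≥0∞) [Fact (1 ≤ p)] (hp' : p ≠ ∞) : IsLpExtension T p (lpExtension T p) := by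
  have h := (existsUnique_isLpExtension hT hsa p hp').exists
  rw [lpExtension, dif_pos h]
  exact h.choose_spec

end MarkovSemigroup

end

namespace MarkovSemigroup

/-! Self-adjointness and the semigroup law give ⟨S_s f, S_t f⟩ = ‖S_{(s+t)/2} f‖². This is
nonincreasing in s + t because each S_t is a contraction, so every orbit in L₂ is Cauchy
(`exists_tendsto_of_isSelfAdjoint`). The limit is fixed by the semigroup and has the same integral
as f.

Irreducibility makes such a limit constant. Subtract the mean to get a fixed d with integral zero.
From |d| ≤ S_t|d| and conservation of the integral, |d| is fixed too, hence so is |d| + d = 2d⁺. The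
positivity set of a nonnegative fixed point gives an invariant subspace
(`IsMarkovOperator.map_mem_L2On`), so d has one sign a.e., and d = 0.

Bounded orbits that converge in L₂ converge in every L_p with p < ∞. Density and L_p-contractivity
then reach all of L_p. Conversely, if L₂(Γ₁) is invariant, the orbit of the indicator of Γ₁ vanishes
off Γ₁, while its limit is the constant σ(Γ₁)/σ(Γ). -/

/-! ### Orbits of self-adjoint contractions -/

/-- The orbits of a semigroup of self-adjoint contractions on a Hilbert space converge as
`t → ∞`. -/
theorem exists_tendsto_of_isSelfAdjoint {H : Type*} [NormedAddCommGroup H] [InnerProductSpace ℝ H]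
    [CompleteSpace H] {S : ℝ → H →L[ℝ] H}
    (hadd : ∀ s t : ℝ, 0 < s → 0 < t → S (s + t) = (S s).comp (S t))
    (hsa : ∀ t : ℝ, 0 < t → IsSelfAdjoint (S t))
    (hc : ∀ t : ℝ, 0 < t → ∀ f, ‖S t f‖ ≤ ‖f‖) (f : H) :
    ∃ g, Tendsto (fun t => S t f) atTop (𝓝 g) := by
  have hinner : ∀ t, 0 < t → ∀ x y : H, inner ℝ (S t x) y = inner ℝ x (S t y) := fun t ht x y => by
    rw [← ContinuousLinearMap.adjoint_inner_right, ← ContinuousLinearMap.star_eq_adjoint,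
      (hsa t ht).star_eq]
  have hmid : ∀ s t, 0 < s → 0 < t →
      inner ℝ (S s f) (S t f) = ‖S ((s + t) / 2) f‖ ^ 2 := fun s t hs ht => by
    have h2 : 0 < (s + t) / 2 := by positivity
    rw [hinner s hs, ← ContinuousLinearMap.comp_apply, ← hadd s t hs ht,
      ← real_inner_self_eq_norm_sq, hinner _ h2, ← ContinuousLinearMap.comp_apply,
      ← hadd _ _ h2 h2, add_halves]
  have hanti : ∀ s t, 0 < s → s ≤ t → ‖S t f‖ ^ 2 ≤ ‖S s f‖ ^ 2 := fun s t hs hst => by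
    rcases hst.eq_or_lt with rfl | hlt
    · rfl
    have h := hadd (t - s) s (sub_pos.2 hlt) hs
    rw [sub_add_cancel] at h
    rw [h]
    gcongr
    exact hc _ (sub_pos.2 hlt) _
  set L : ℝ := sInf ((fun t => ‖S t f‖ ^ 2) '' Set.Ioi 0)
  have hbdd : BddBelow ((fun t => ‖S t f‖ ^ 2) '' Set.Ioi (0 : ℝ)) :=
    ⟨0, by rintro _ ⟨t, -, rfl⟩; positivity⟩
  have hL : ∀ t, 0 < t → L ≤ ‖S t f‖ ^ 2 := fun t ht => csInf_le hbdd ⟨t, ht, rfl⟩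
  refine cauchySeq_tendsto_of_complete (Metric.cauchySeq_iff.2 fun ε hε => ?_)
  -- For s, t ≥ N, ‖S_s f - S_t f‖² is at most 2‖S_N f‖² - 2L, hence the margin ε²/2.
  obtain ⟨_, ⟨N, hN, rfl⟩, hNL⟩ := exists_lt_of_csInf_lt
    ((Set.nonempty_Ioi (a := (0 : ℝ))).image fun t => ‖S t f‖ ^ 2)
    (show L < L + ε ^ 2 / 2 by linarith [pow_pos hε 2])
  refine ⟨N, fun s hs t ht => ?_⟩
  have hN : 0 < N := hN
  have hs0 : 0 < s := hN.trans_le hs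
  have ht0 : 0 < t := hN.trans_le ht
  rw [dist_eq_norm]
  refine lt_of_pow_lt_pow_left₀ 2 hε.le ?_
  rw [norm_sub_sq_real, hmid s t hs0 ht0]
  have h1 := hanti N s hN hs
  have h2 := hanti N t hN ht
  have h3 := hL ((s + t) / 2) (by positivity)
  simp only at hNL
  linarith

/-! ### Disjoint supports and change of exponent -/

variable {Γ : Type*} [MeasurableSpace Γ] {σ : Measure Γ}

theorem inner_map_left {T : Lp ℝ 2 σ →L[ℝ] Lp ℝ 2 σ} (hsa : IsSelfAdjoint T) (f g : Lp ℝ 2 σ) :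
    inner ℝ (T f) g = inner ℝ f (T g) := by
  rw [← ContinuousLinearMap.adjoint_inner_right, ← ContinuousLinearMap.star_eq_adjoint,
    hsa.star_eq]

/-- Disjointness of supports becomes orthogonality, which a self-adjoint operator can carry from one
factor to the other. -/
theorem inner_eq_zero_iff_of_nonneg {f g : Lp ℝ 2 σ} (hf : 0 ≤ f) (hg : 0 ≤ g) :
    inner ℝ f g = 0 ↔ ∀ᵐ x ∂σ, f x = 0 ∨ g x = 0 := by
  rw [← Lp.coeFn_nonneg] at hf hg
  have hnn : 0 ≤ᵐ[σ] fun x => inner ℝ (f x) (g x) := by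
    filter_upwards [hf, hg] with x h1 h2
    simpa using mul_nonneg h2 h1
  rw [L2.inner_def, integral_eq_zero_iff_of_nonneg_ae hnn (L2.integrable_inner f g)]
  refine eventually_congr (ae_of_all _ fun x => ?_)
  simp [or_comm]

/-- Integrate |u|^p ≤ K^(p-2) |u|². -/
theorem eLpNorm_le_of_two_le {p : ℝ≥0∞} (hp2 : 2 ≤ p) (hp' : p ≠ ∞) {u : Γ → ℝ} {K : ℝ≥0∞}
    (hKt : K ≠ ∞) (hK : ∀ᵐ x ∂σ, ‖u x‖ₑ ≤ K) :
    eLpNorm u p σ ≤ (K ^ (p.toReal - 2) * eLpNorm u 2 σ ^ (2 : ℝ)) ^ (1 / p.toReal) := by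
  have hq : 2 ≤ p.toReal := by simpa using ENNReal.toReal_mono hp' hp2
  have h2 : eLpNorm u 2 σ ^ (2 : ℝ) = ∫⁻ x, ‖u x‖ₑ ^ (2 : ℝ) ∂σ := by
    rw [eLpNorm_eq_lintegral_rpow_enorm_toReal two_ne_zero ENNReal.ofNat_ne_top,
      ← ENNReal.rpow_mul]
    simp
  rw [eLpNorm_eq_lintegral_rpow_enorm_toReal (two_pos.trans_le hp2).ne' hp', h2]
  refine ENNReal.rpow_le_rpow ((lintegral_mono_ae ?_).trans_eq (lintegral_const_mul' _ _
    (ENNReal.rpow_ne_top_of_nonneg (by linarith) hKt))) (by positivity)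
  filter_upwards [hK] with x hx
  calc ‖u x‖ₑ ^ p.toReal = ‖u x‖ₑ ^ (p.toReal - 2) * ‖u x‖ₑ ^ (2 : ℝ) := by
        rw [← ENNReal.rpow_add_of_nonneg _ _ (by linarith) zero_le_two, sub_add_cancel]
    _ ≤ _ := by gcongr

/-- For p ≤ 2 the finite measure and Hölder suffice; for p ≥ 2 the uniform bound enters by
interpolation. -/
theorem tendsto_eLpNorm_zero_of_bounded [IsFiniteMeasure σ] {ι : Type*} {l : Filter ι} {p : ℝ≥0∞}
    (hp' : p ≠ ∞) {u : ι → Γ → ℝ} (hm : ∀ i, AEStronglyMeasurable (u i) σ)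
    {K : ℝ≥0∞} (hKt : K ≠ ∞) (hK : ∀ᶠ i in l, ∀ᵐ x ∂σ, ‖u i x‖ₑ ≤ K)
    (h : Tendsto (fun i => eLpNorm (u i) 2 σ) l (𝓝 0)) :
    Tendsto (fun i => eLpNorm (u i) p σ) l (𝓝 0) := by
  rcases le_total p 2 with hp2 | hp2
  · by_cases hp0 : p = 0
    · simpa [hp0] using tendsto_const_nhds
    refine tendsto_of_tendsto_of_tendsto_of_le_of_le tendsto_const_nhds ?_ (fun _ => zero_le)
      (fun i => eLpNorm_le_eLpNorm_mul_rpow_measure_univ hp2 (hm i))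
    have hC : σ Set.univ ^ (1 / p.toReal - 1 / ENNReal.toReal 2) ≠ ∞ := by
      refine ENNReal.rpow_ne_top_of_nonneg (sub_nonneg.2 ?_) (measure_ne_top _ _)
      exact one_div_le_one_div_of_le (ENNReal.toReal_pos hp0 hp')
        (ENNReal.toReal_mono ENNReal.ofNat_ne_top hp2)
    simpa using ENNReal.Tendsto.mul_const h (.inr hC)
  · have hq : 2 ≤ p.toReal := by simpa using ENNReal.toReal_mono hp' hp2
    have hC : K ^ (p.toReal - 2) ≠ ∞ :=
      ENNReal.rpow_ne_top_of_nonneg (by linarith) hKt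
    refine tendsto_of_tendsto_of_tendsto_of_le_of_le' tendsto_const_nhds ?_
      (.of_forall fun _ => zero_le) (hK.mono fun i hi => eLpNorm_le_of_two_le hp2 hp' hKt hi)
    have h2 := (ENNReal.Tendsto.const_mul (h.ennrpow_const 2) (.inr hC)).ennrpow_const
      (1 / p.toReal)
    rwa [ENNReal.zero_rpow_of_pos two_pos, mul_zero,
      ENNReal.zero_rpow_of_pos (by positivity)] at h2

/-! ### Fixed points of a Markov operator -/

variable [IsFiniteMeasure σ] {T : Lp ℝ 2 σ →L[ℝ] Lp ℝ 2 σ}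

theorem IsMarkovOperator.abs_map_le (hT : IsMarkovOperator σ T) (f : Lp ℝ 2 σ) :
    |T f| ≤ T |f| :=
  abs_le'.2 ⟨hT.mono (le_abs_self f), by rw [← map_neg]; exact hT.mono (neg_le_abs f)⟩

theorem IsMarkovOperator.norm_map_le (hT : IsMarkovOperator σ T) (hsa : IsSelfAdjoint T)
    (f : Lp ℝ 2 σ) : ‖T f‖ ≤ ‖f‖ := by
  rw [Lp.norm_def, Lp.norm_def]
  exact ENNReal.toReal_mono (Lp.eLpNorm_ne_top _)
    (eLpNorm_map_le hT hsa one_le_two ENNReal.ofNat_ne_top f (Lp.memLp f))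

theorem integrable_coeFn {p : ℝ≥0∞} [hp : Fact (1 ≤ p)] (f : Lp ℝ p σ) : Integrable f σ :=
  (Lp.memLp f).integrable hp.out

/-- Turns one-sided bounds into equalities: for |f| ≤ T|f| with T preserving integrals, and for a
function of one sign with integral zero. -/
theorem eq_of_le_of_integral_eq {f g : Lp ℝ 2 σ} (hle : f ≤ g)
    (h : ∫ x, f x ∂σ = ∫ x, g x ∂σ) : f = g :=
  Lp.ext ((integral_eq_iff_of_ae_le (integrable_coeFn f) (integrable_coeFn g)
    ((Lp.coeFn_le _ _).2 hle)).1 h)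

/-- The fixed space of a self-adjoint Markov operator is a sublattice. -/
theorem IsMarkovOperator.map_abs_of_map_eq (hT : IsMarkovOperator σ T) (hsa : IsSelfAdjoint T)
    {f : Lp ℝ 2 σ} (hf : T f = f) : T |f| = |f| := by
  have h := hT.abs_map_le f
  rw [hf] at h
  exact (eq_of_le_of_integral_eq h (integral_map_eq hT hsa _).symm).symm

/-- If `g ≥ 0` is a fixed point of a self-adjoint Markov operator, then the functions that vanish
off `{g > 0}` form an invariant subspace. -/
theorem IsMarkovOperator.map_mem_L2On (hT : IsMarkovOperator σ T) (hsa : IsSelfAdjoint T)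
    {g : Lp ℝ 2 σ} (hg0 : 0 ≤ g) (hg : T g = g) {h : Lp ℝ 2 σ} (hh : h ∈ L2On σ {x | 0 < g x}) :
    T h ∈ L2On σ {x | 0 < g x} := by
  have hm : MeasurableSet {x | 0 < g x} :=
    measurableSet_lt measurable_const (Lp.stronglyMeasurable g).measurable
  -- k is the indicator of the set where g = 0. Since ⟨Tk, g⟩ = ⟨k, Tg⟩ = ⟨k, g⟩ = 0, Tk vanishes
  -- where g > 0.
  set k : Lp ℝ 2 σ := indicatorConstLp 2 hm.compl (measure_ne_top σ _) (1 : ℝ)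
  have hk : k =ᵐ[σ] {x | 0 < g x}ᶜ.indicator fun _ => (1 : ℝ) := indicatorConstLp_coeFn
  have hk0 : 0 ≤ k := by
    rw [← Lp.coeFn_nonneg]
    filter_upwards [hk] with x hx
    rw [hx]
    exact Set.indicator_nonneg (fun _ _ => zero_le_one) x
  have hTk0 := hT.map_nonneg k hk0
  have hTk : ∀ᵐ x ∂σ, T k x = 0 ∨ g x = 0 := by
    rw [← inner_eq_zero_iff_of_nonneg hTk0 hg0, inner_map_left hsa, hg,
      inner_eq_zero_iff_of_nonneg hk0 hg0]
    filter_upwards [hk, (Lp.coeFn_nonneg _).2 hg0] with x hx hgx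
    rw [hx]
    rcases hgx.eq_or_lt with h | h
    · exact .inr h.symm
    · exact .inl (Set.indicator_of_notMem (not_not.2 h) _)
  -- ⟨T|h|, k⟩ = ⟨|h|, Tk⟩ = 0, as |h| lives on {g > 0}; then |Th| ≤ T|h| finishes.
  have hTh : ∀ᵐ x ∂σ, T |h| x = 0 ∨ k x = 0 := by
    rw [← inner_eq_zero_iff_of_nonneg (hT.map_nonneg _ (abs_nonneg h)) hk0, inner_map_left hsa,
      inner_eq_zero_iff_of_nonneg (abs_nonneg h) hTk0]
    filter_upwards [hh, hTk, Lp.coeFn_abs h] with x h1 h2 h3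
    rw [h3, abs_eq_zero]
    rcases h2 with h2 | h2
    · exact .inr h2
    · exact .inl (h1 (by simp [h2]))
  filter_upwards [hTh, hk, (Lp.coeFn_le _ _).2 (hT.abs_map_le h), Lp.coeFn_abs (T h)]
    with x h1 h2 h3 h4 hx
  rw [h2, Set.indicator_of_mem (by exact hx)] at h1
  rw [h4, h1.resolve_right one_ne_zero] at h3
  exact abs_nonpos_iff.1 h3

/-! ### The mean and convergence in L₂ -/

theorem coeFn_mean {p : ℝ≥0∞} (f : Lp ℝ p σ) :
    mean σ p f =ᵐ[σ] fun _ => (σ.real Set.univ)⁻¹ * ∫ x, f x ∂σ :=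
  Lp.coeFn_const _ _ _

theorem integral_mean {p : ℝ≥0∞} (f : Lp ℝ p σ) : ∫ x, mean σ p f x ∂σ = ∫ x, f x ∂σ := by
  rw [integral_congr_ae (coeFn_mean f), integral_const, smul_eq_mul]
  by_cases h : σ = 0
  · simp [h]
  · have : NeZero σ := ⟨h⟩
    rw [mul_inv_cancel_left₀ measureReal_univ_ne_zero]

/-- The fixed points of an irreducible semigroup are the constants. -/
theorem IsSelfAdjointMarkovSemigroup.eq_mean_of_forall_map_eq
    {S : ℝ → Lp ℝ 2 σ →L[ℝ] Lp ℝ 2 σ} (hS : IsSelfAdjointMarkovSemigroup σ S)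
    (hirr : IsIrreducible σ S) {f : Lp ℝ 2 σ} (hf : ∀ t, 0 < t → S t f = f) :
    f = mean σ 2 f := by
  set d := f - mean σ 2 f with hd
  have hdS : ∀ t, 0 < t → S t d = d := fun t ht => by
    rw [hd, map_sub, hf t ht, mean, (hS.isMarkovOperator t ht).map_const]
  have hdint : ∫ x, d x ∂σ = 0 := by
    rw [integral_congr_ae (Lp.coeFn_sub f (mean σ 2 f))]
    simp only [Pi.sub_apply]
    rw [integral_sub (integrable_coeFn _) (integrable_coeFn _), integral_mean, sub_self]
  -- g is twice the positive part of d, so {g > 0} = {d > 0} up to a null set.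
  set g := |d| + d with hg
  have hg0 : 0 ≤ g := by
    rw [hg, ← neg_le_iff_add_nonneg]; exact neg_le_abs d
  have hgS : ∀ t, 0 < t → S t g = g := fun t ht => by
    rw [hg, map_add, hdS t ht,
      (hS.isMarkovOperator t ht).map_abs_of_map_eq (hS.isSelfAdjoint t ht) (hdS t ht)]
  have hgd : ∀ᵐ x ∂σ, 0 < g x ↔ 0 < d x := by
    filter_upwards [Lp.coeFn_add |d| d, Lp.coeFn_abs d] with x h1 h2
    rw [hg, h1, Pi.add_apply, h2]
    constructor <;> intro h
    · by_contra! h'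
      rw [abs_of_nonpos h'] at h; linarith
    · positivity
  have hz : d = 0 := by
    have hint0 : ∫ x, (0 : Lp ℝ 2 σ) x ∂σ = 0 := by
      rw [integral_congr_ae (Lp.coeFn_zero ℝ 2 σ)]; simp
    rcases hirr {x | 0 < g x}
      (measurableSet_lt measurable_const (Lp.stronglyMeasurable g).measurable)
      (fun t ht h hh => (hS.isMarkovOperator t ht).map_mem_L2On (hS.isSelfAdjoint t ht) hg0
        (hgS t ht) hh) with h | h
    · refine eq_of_le_of_integral_eq ?_ (hdint.trans hint0.symm)
      rw [← Lp.coeFn_le]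
      filter_upwards [measure_eq_zero_iff_ae_notMem.1 h, hgd, Lp.coeFn_zero ℝ 2 σ] with x h1 h2 h3
      rw [h3]
      exact not_lt.1 fun h' => h1 (h2.2 h')
    · refine (eq_of_le_of_integral_eq ?_ (hint0.trans hdint.symm)).symm
      rw [← Lp.coeFn_nonneg]
      filter_upwards [measure_eq_zero_iff_ae_notMem.1 h, hgd] with x h1 h2
      exact (h2.1 (not_not.1 h1)).le
  exact sub_eq_zero.1 hz

/-- Convergence to the mean in `L₂(Γ)` for an irreducible semigroup. -/
theorem IsSelfAdjointMarkovSemigroup.tendsto_mean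
    {S : ℝ → Lp ℝ 2 σ →L[ℝ] Lp ℝ 2 σ} (hS : IsSelfAdjointMarkovSemigroup σ S)
    (hirr : IsIrreducible σ S) (f : Lp ℝ 2 σ) :
    Tendsto (fun t => S t f) atTop (𝓝 (mean σ 2 f)) := by
  obtain ⟨g, hg⟩ := exists_tendsto_of_isSelfAdjoint hS.isC0Semigroup.map_add hS.isSelfAdjoint
    (fun t ht => (hS.isMarkovOperator t ht).norm_map_le (hS.isSelfAdjoint t ht)) f
  -- S_s S_t f = S_{s+t} f tends both to S_s g and to g.
  have hfix : ∀ s, 0 < s → S s g = g := fun s hs => by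
    refine tendsto_nhds_unique (((S s).continuous.tendsto g).comp hg)
      ((hg.comp (tendsto_atTop_add_const_left atTop s tendsto_id)).congr' ?_)
    filter_upwards [eventually_gt_atTop 0] with t ht
    simp [hS.isC0Semigroup.map_add s t hs ht]
  have hint : ∫ x, g x ∂σ = ∫ x, f x ∂σ := by
    have hinner : ∀ u : Lp ℝ 2 σ, inner ℝ (Lp.const 2 σ (1 : ℝ)) u = ∫ x, u x ∂σ := fun u => by
      rw [L2.inner_def]
      refine integral_congr_ae ?_
      filter_upwards [Lp.coeFn_const 2 σ (1 : ℝ)] with x hx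
      rw [hx]; simp
    rw [← hinner, ← hinner]
    refine tendsto_nhds_unique (tendsto_const_nhds.inner hg)
      (tendsto_const_nhds.congr' ?_)
    filter_upwards [eventually_gt_atTop 0] with t ht
    rw [hinner, hinner, integral_map_eq (hS.isMarkovOperator t ht) (hS.isSelfAdjoint t ht)]
  rwa [hS.eq_mean_of_forall_map_eq hirr hfix, mean, hint, ← mean] at hg

/-! ### Convergence in L_p -/

theorem mean_add {p : ℝ≥0∞} [Fact (1 ≤ p)] (f g : Lp ℝ p σ) :
    mean σ p (f + g) = mean σ p f + mean σ p g := by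
  rw [mean, integral_congr_ae (Lp.coeFn_add f g)]
  simp only [Pi.add_apply]
  rw [integral_add (integrable_coeFn f) (integrable_coeFn g), mul_add, map_add]
  rfl

/-- On a finite measure space L_p embeds continuously in L₁. Continuity of the limit map is needed
for the density argument. -/
theorem continuous_mean {p : ℝ≥0∞} [hp : Fact (1 ≤ p)] : Continuous (mean σ p) := by
  have hint : Continuous fun f : Lp ℝ p σ => ∫ x, f x ∂σ := by
    refine continuous_iff_continuousAt.2 fun f => ?_
    refine tendsto_integral_of_L1' f (integrable_coeFn f).1
      (.of_forall fun g => integrable_coeFn g) ?_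
    have h1 : Tendsto (fun g : Lp ℝ p σ => eLpNorm (⇑g - ⇑f) p σ) (𝓝 f) (𝓝 0) :=
      (Lp.tendsto_Lp_iff_tendsto_eLpNorm' _ _).1 tendsto_id
    have hC : σ Set.univ ^ (1 / (1 : ℝ≥0∞).toReal - 1 / p.toReal) ≠ ∞ := by
      refine ENNReal.rpow_ne_top_of_nonneg (sub_nonneg.2 ?_) (measure_ne_top _ _)
      -- For p = ∞, `p.toReal` is 0 and 1 / 0 = 0, so the exponent is 1.
      rcases eq_or_ne p ∞ with rfl | hp'
      · simp
      · exact one_div_le_one_div_of_le (by simp) (ENNReal.toReal_mono hp' hp.out)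
    refine tendsto_of_tendsto_of_tendsto_of_le_of_le tendsto_const_nhds ?_ (fun _ => zero_le)
      (fun g => eLpNorm_le_eLpNorm_mul_rpow_measure_univ hp.out
        ((Lp.aestronglyMeasurable g).sub (Lp.aestronglyMeasurable f)))
    simpa using ENNReal.Tendsto.mul_const h1 (.inr hC)
  exact (Lp.constL p σ ℝ).continuous.comp (continuous_const.mul hint)

/-- A self-adjoint Markov operator does not increase the supremum norm. -/
theorem IsMarkovOperator.ae_abs_map_le (hT : IsMarkovOperator σ T)
    {f : Lp ℝ 2 σ} {M : ℝ} (hf : ∀ᵐ x ∂σ, |f x| ≤ M) : ∀ᵐ x ∂σ, |T f x| ≤ M := by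
  have h : |f| ≤ Lp.const 2 σ M := by
    rw [← Lp.coeFn_le]
    filter_upwards [hf, Lp.coeFn_abs f, Lp.coeFn_const 2 σ M] with x h1 h2 h3
    rwa [h2, h3]
  have h' := (hT.abs_map_le f).trans (hT.mono h)
  rw [hT.map_const, ← Lp.coeFn_le] at h'
  filter_upwards [h', Lp.coeFn_abs (T f), Lp.coeFn_const 2 σ M] with x h1 h2 h3
  rwa [h2, h3] at h1

/-- The bound holds on the dense subspace L_p ∩ L₂ and is a closed condition. It makes the semigroup
equicontinuous on L_p. -/
theorem norm_lpExtension_le (hT : IsMarkovOperator σ T)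
    (hsa : IsSelfAdjoint T) (p : ℝ≥0∞) [hp : Fact (1 ≤ p)] (hp' : p ≠ ∞) (f : Lp ℝ p σ) :
    ‖lpExtension T p f‖ ≤ ‖f‖ := by
  refine (denseRange_interLpIncl σ p hp').induction_on f
    (isClosed_le (by fun_prop) (by fun_prop)) fun g => ?_
  have hg := coeFn_interLpIncl g
  rw [Lp.norm_def, Lp.norm_def]
  refine ENNReal.toReal_mono (Lp.eLpNorm_ne_top _) ?_
  rw [← eLpNorm_congr_ae (isLpExtension_lpExtension hT hsa p hp' g _ hg.symm),
    eLpNorm_congr_ae hg]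
  exact eLpNorm_map_le hT hsa hp.out hp' _ (memLp_of_mem g)

variable {S : ℝ → Lp ℝ 2 σ →L[ℝ] Lp ℝ 2 σ}

/-- The sup bound M persists along the orbit, so its distance to the constant m stays below M + |m|,
and L₂ convergence upgrades to L_p. -/
theorem IsSelfAdjointMarkovSemigroup.tendsto_lpExtension_of_bounded
    (hS : IsSelfAdjointMarkovSemigroup σ S) (hirr : IsIrreducible σ S)
    {p : ℝ≥0∞} [Fact (1 ≤ p)] (hp' : p ≠ ∞) {f : Lp ℝ 2 σ} {g : Lp ℝ p σ} (hfg : f =ᵐ[σ] g)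
    {M : ℝ} (hf : ∀ᵐ x ∂σ, |f x| ≤ M) :
    Tendsto (fun t => lpExtension (S t) p g) atTop (𝓝 (mean σ p g)) := by
  set m : ℝ := (σ.real Set.univ)⁻¹ * ∫ x, f x ∂σ
  have hmg : mean σ p g =ᵐ[σ] fun _ => m := by
    simpa only [m, integral_congr_ae hfg] using coeFn_mean g
  have h2 := (Lp.tendsto_Lp_iff_tendsto_eLpNorm' _ _).1 (hS.tendsto_mean hirr f)
  have hp := tendsto_eLpNorm_zero_of_bounded hp' (K := ENNReal.ofReal (M + |m|))
    (fun t => (Lp.aestronglyMeasurable (S t f)).sub (Lp.aestronglyMeasurable _))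
    ENNReal.ofReal_ne_top ?_ h2
  · rw [Lp.tendsto_Lp_iff_tendsto_eLpNorm']
    refine hp.congr' ?_
    filter_upwards [eventually_gt_atTop 0] with t ht
    exact eLpNorm_congr_ae ((isLpExtension_lpExtension (hS.isMarkovOperator t ht)
      (hS.isSelfAdjoint t ht) p hp' f g hfg).sub ((coeFn_mean f).trans hmg.symm))
  · filter_upwards [eventually_gt_atTop 0] with t ht
    filter_upwards [(hS.isMarkovOperator t ht).ae_abs_map_le hf, coeFn_mean f] with x h1 h3
    rw [Pi.sub_apply, h3, ← ofReal_norm, Real.norm_eq_abs]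
    exact ENNReal.ofReal_le_ofReal ((abs_sub _ _).trans (by gcongr))

/-- Convergence to the mean in `L_p(Γ)` for an irreducible semigroup. -/
theorem IsSelfAdjointMarkovSemigroup.tendsto_lpExtension
    (hS : IsSelfAdjointMarkovSemigroup σ S) (hirr : IsIrreducible σ S)
    (p : ℝ≥0∞) [Fact (1 ≤ p)] (hp' : p ≠ ∞) (f : Lp ℝ p σ) :
    Tendsto (fun t => lpExtension (S t) p f) atTop (𝓝 (mean σ p f)) := by
  induction f using Lp.induction hp' with
  | @indicatorConst c s hs hμs =>
    refine hS.tendsto_lpExtension_of_bounded hirr hp' (f := indicatorConstLp 2 hs hμs.ne c)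
      (M := |c|) ?_ ?_
    · rw [Lp.simpleFunc.coe_indicatorConst]
      exact indicatorConstLp_coeFn.trans indicatorConstLp_coeFn.symm
    · filter_upwards [indicatorConstLp_coeFn (p := 2) (hs := hs) (hμs := hμs.ne) (c := c)]
        with x hx
      rw [hx]
      by_cases h : x ∈ s <;> simp [h]
  | add hf hg _ h1 h2 =>
    rw [mean_add]
    simpa only [map_add] using h1.add h2
  | isClosed =>
    -- Contractivity is known only for t > 0; `max t 1` is always positive and equals t once t ≥ 1.
    -- For an equicontinuous family and a continuous limit, the convergence set is closed.
    have hmax : ∀ t : ℝ, 0 < max t 1 := fun t => lt_max_of_lt_right one_pos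
    have heq : Equicontinuous fun (t : ℝ) (f : Lp ℝ p σ) => lpExtension (S (max t 1)) p f := by
      refine (LipschitzWith.uniformEquicontinuous _ 1 fun t => ?_).equicontinuous
      refine LipschitzWith.of_dist_le_mul fun f g => ?_
      rw [dist_eq_norm, dist_eq_norm, ← map_sub, NNReal.coe_one, one_mul]
      exact norm_lpExtension_le (hS.isMarkovOperator _ (hmax t)) (hS.isSelfAdjoint _ (hmax t))
        p hp' _
    convert heq.isClosed_setOfPred_tendsto (l := atTop) (continuous_mean (σ := σ) (p := p))
      using 3 with f
    refine tendsto_congr' ?_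
    filter_upwards [eventually_ge_atTop 1] with t ht
    rw [max_eq_left ht]

/-! ### Convergence forces irreducibility -/

theorem IsSelfAdjointMarkovSemigroup.isIrreducible_of_tendsto
    (hS : IsSelfAdjointMarkovSemigroup σ S) {p : ℝ≥0∞} [Fact (1 ≤ p)] (hp' : p ≠ ∞)
    (h : ∀ f : Lp ℝ p σ,
      Tendsto (fun t => lpExtension (S t) p f) atTop (𝓝 (mean σ p f))) :
    IsIrreducible σ S := by
  intro Γ₁ hm hinv
  set f : Lp ℝ 2 σ := indicatorConstLp 2 hm (measure_ne_top σ _) (1 : ℝ)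
  set g : Lp ℝ p σ := indicatorConstLp p hm (measure_ne_top σ _) (1 : ℝ)
  have hg : g =ᵐ[σ] Γ₁.indicator fun _ => (1 : ℝ) := indicatorConstLp_coeFn
  have hfg : f =ᵐ[σ] g := indicatorConstLp_coeFn.trans hg.symm
  have hf : f ∈ L2On σ Γ₁ := by
    filter_upwards [hfg, hg] with x h1 h2 hx
    rw [h1, h2, Set.indicator_of_notMem hx]
  -- A sequence of positive times lets one null set serve all of them, and a subsequence converges
  -- a.e.
  have hseq : Tendsto (fun n : ℕ => lpExtension (S ((n : ℝ) + 1)) p g) atTop (𝓝 (mean σ p g)) :=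
    (h g).comp (tendsto_atTop_add_const_right _ _ tendsto_natCast_atTop_atTop)
  obtain ⟨φ, -, hφ⟩ := (tendstoInMeasure_of_tendsto_Lp hseq).exists_seq_tendsto_ae
  have hz : ∀ᵐ x ∂σ, ∀ n : ℕ, x ∉ Γ₁ → lpExtension (S ((n : ℝ) + 1)) p g x = 0 := by
    rw [ae_all_iff]
    intro n
    have hn : (0 : ℝ) < n + 1 := by positivity
    filter_upwards [hinv _ hn f hf, isLpExtension_lpExtension (hS.isMarkovOperator _ hn)
      (hS.isSelfAdjoint _ hn) p hp' f g hfg] with x h1 h2 hx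
    rw [← h2, h1 hx]
  have hint : ∫ x, g x ∂σ = σ.real Γ₁ := by
    rw [integral_congr_ae hg, integral_indicator_const _ hm, smul_eq_mul, mul_one]
  by_cases h0 : σ Γ₁ = 0
  · exact .inl h0
  refine .inr (measure_eq_zero_iff_ae_notMem.2 ?_)
  filter_upwards [hφ, hz, coeFn_mean g] with x h1 h2 h3 hx
  have h4 : mean σ p g x = 0 :=
    tendsto_nhds_unique h1 (tendsto_const_nhds.congr fun n => (h2 (φ n) hx).symm)
  rw [h3, hint] at h4
  have h5 : 0 < σ.real Γ₁ := ENNReal.toReal_pos h0 (measure_ne_top _ _)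
  have h6 : 0 < σ.real Set.univ := h5.trans_le (measureReal_mono (Set.subset_univ _))
  exact (mul_pos (inv_pos.2 h6) h5).ne' h4

end MarkovSemigroup

theorem theorem2p3 {Γ : Type*} [MeasurableSpace Γ] (σ : Measure Γ) [IsFiniteMeasure σ]
    (S : ℝ → Lp ℝ 2 σ →L[ℝ] Lp ℝ 2 σ)
    (hS : MarkovSemigroup.IsSelfAdjointMarkovSemigroup σ S) :
    List.TFAE [
      MarkovSemigroup.IsIrreducible σ S,
      ∃ (p : ℝ≥0∞) (_ : Fact (1 ≤ p)), p ≠ ∞ ∧ ∀ f : Lp ℝ p σ,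
        Tendsto (fun t : ℝ => MarkovSemigroup.lpExtension (S t) p f) atTop
          (𝓝 (MarkovSemigroup.mean σ p f)),
      ∀ (p : ℝ≥0∞) [Fact (1 ≤ p)], p ≠ ∞ → ∀ f : Lp ℝ p σ,
        Tendsto (fun t : ℝ => MarkovSemigroup.lpExtension (S t) p f) atTop
          (𝓝 (MarkovSemigroup.mean σ p f))] := by
  tfae_have 1 → 3 := fun hirr p _ hp' f => hS.tendsto_lpExtension hirr p hp' f
  tfae_have 3 → 2 := fun h => ⟨1, ⟨le_rfl⟩, ENNReal.one_ne_top, h 1 ENNReal.one_ne_top⟩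
  tfae_have 2 → 1 := fun ⟨_, _, hp', h⟩ => hS.isIrreducible_of_tendsto hp' h
  tfae_finish
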